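/- Let $A,B:\mathbb{N}_0\to\mathbb{R}$ with $\sum_{x\ge 0}\big(A(x)^2+B(x)^2\big)<\infty$, put $a(x)=[A(x),B(x)]^T$ and $F=\begin{bmatrix}0&-1\\1&0\end{bmatrix}$. Suppose there are real $2\times 2$ matrices $S_x$ $(x\in\mathbb{N}_0)$ with $a(x+1)=S_xa(x)$ for all $x\in\mathbb{N}_0$, and a constant real matrix $C$ with $$C=\frac{S_y^TFS_x-F}{x-y}\qquad\text{for all } x\ne y \text{ in } \mathbb{N}_0 .$$ Suppose that $C$ has eigenvalues $\lambda_0\in\mathbb{R}\setminus\{0\}$ and $0$, let $[\alpha,\beta]^T$ be a real unit eigenvector of $C$ for $\lambda_0$, and put $\phi(x)=|\lambda_0|^{1/2}\big(\alpha A(x)+\beta B(x)\big)$. Suppose also that $\sum_{n\ge 0}n\,\phi(n)^2<\infty$. Define $$K(x,y)=-\operatorname{sgn}(\lambda_0)\,\frac{A(x)B(y)-A(y)B(x)}{x-y}\quad(x\neq y),\qquad K(x,x)=\sum_{k=0}^\infty\phi(x+k)^2 .$$ For a compact self-adjoint operator $W$ on a Hilbert space $H$ and $t\in\mathbb{R}$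 let $\nu_W(t)=\dim\{f\in H: Wf=tf\}\in\{0,1,2,\dots\}\cup\{\infty\}$. Then the Hankel matrix $[\phi(m+n)]_{m,n\ge 0}$ and the matrix $[K(x,y)]_{x,y\ge 0}$ represent bounded operators $\Gamma_\phi$ and $K$ on the complex Hilbert space $\ell^2(\mathbb{N}_0)$, $K=\Gamma_\phi^2$, both operators are compact and self-adjoint, and: (i) $\nu_K(0)=0$ or $\nu_K(0)=\infty$; (ii) for every $t>0$, $\nu_K(t)<\infty$ and $\nu_K(t)=\nu_{\Gamma_\phi}(\sqrt t)+\nu_{\Gamma_\phi}(-\sqrt t)$; (iii) for every $t>0$, if $\nu_K(t)$ is even, then $\nu_{\Gamma_\phi}(\sqrt t)=\nu_{\Gamma_\phi}(-\sqrt t)$; (iv) for every $t>0$, if $\nu_K(t)$ is odd, then $|\nu_{\Gamma_\phi}(\sqrt t)-\nu_{\Gamma_\phi}(-\sqrt t)|=1$. -/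

import Mathlib

open Matrix

noncomputable section

namespace DiscreteIntegrable

/-- The complex Hilbert space `ℓ²(ℕ₀)`. -/
abbrev Ell2 : Type := lp (fun _ : ℕ => ℂ) 2

/-- The bounded operator `T` on `ℓ²` is represented by the infinite real matrix `M`:
`(T f)(m) = ∑ₙ M(m,n) f(n)`, with a convergent series, for every `f` and `m`.
There is at most one such `T`. -/
def IsRepresentedBy (T : Ell2 →L[ℂ] Ell2) (M : ℕ → ℕ → ℝ) : Prop :=
  ∀ (f : Ell2) (m : ℕ), HasSum (fun n : ℕ => (M m n : ℂ) * f n) (T f m)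

/-- The Hankel matrix `[φ(m+n)]`. -/
def hankelMatrix (φ : ℕ → ℝ) (m n : ℕ) : ℝ := φ (m + n)

/-- The matrix `F = [[0, -1], [1, 0]]`. -/
def matF : Matrix (Fin 2) (Fin 2) ℝ := !![0, -1; 1, 0]

/-- The column vector `a(x) = [A(x), B(x)]ᵀ`. -/
def vecA (A B : ℕ → ℝ) (x : ℕ) : Fin 2 → ℝ := ![A x, B x]

/-- The Tracy--Widom kernel `⟨F a(x), a(y)⟩ / (x - y) = (A(x)B(y) - A(y)B(x)) / (x - y)`.
It is only used for `x ≠ y`. -/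
def twKernel (A B : ℕ → ℝ) (x y : ℕ) : ℝ :=
  ((matF *ᵥ vecA A B x) ⬝ᵥ vecA A B y) / ((x : ℝ) - (y : ℝ))

/-- `φ(x) = |ev|^{1/2} (α A(x) + β B(x))`. -/
def hankelSymbol (A B : ℕ → ℝ) (ev α β : ℝ) (x : ℕ) : ℝ :=
  Real.sqrt |ev| * (α * A x + β * B x)

/-- The Tracy--Widom kernel with its sign normalised, `-sgn(ev) K(x,y)` (this is `K(x,y)` itself if
`ev < 0`), off the diagonal, extended to the diagonal by `∑ₖ φ(x+k)²`. -/
def extendedKernel (A B : ℕ → ℝ) (ev α β : ℝ) (x y : ℕ) : ℝ :=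
  if x = y then ∑' k : ℕ, hankelSymbol A B ev α β (x + k) ^ 2
  else -Real.sign ev * twKernel A B x y

/-- The spectral multiplicity function `ν_W(t) = dim {x : W x = t x}`, with values in
`{0, 1, …} ∪ {∞}`. -/
def specMult {H : Type*} [NormedAddCommGroup H] [InnerProductSpace ℂ H]
    (W : H →L[ℂ] H) (t : ℝ) : ℕ∞ :=
  Cardinal.toENat
    (Module.rank ℂ (Module.End.eigenspace (W : H →ₗ[ℂ] H) (t : ℂ)))

end DiscreteIntegrable

end

namespace DiscreteIntegrable

open Filter Topology

/-! ### Scalar part: the kernel as a sum of products -/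

/-! The matrix `C` is symmetric, because exchanging `x` and `y` transposes its formula, and
singular, so it equals `ev` times the projection onto its unit eigenvector. Thus the kernel drops by
φ(x)φ(y) when both arguments advance by one. It tends to 0 along diagonals, so it telescopes to ∑ₖ
φ(x+k)φ(y+k), which is the matrix of Γ². The weighted summability of φ² makes Γ Hilbert–Schmidt.

Let R and L be the forward and backward shifts. The Hankel structure gives ΓR = LΓ, hence ker Γ² =
ker Γ is R-invariant; R has no eigenvector, so this kernel is zero or infinite-dimensional. For s ≠
0, the injective map R - L carries a subspace of codimension at most 1 of the s-eigenspace into the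
(-s)-eigenspace (`finrank_eigenspace_le`). The two multiplicities therefore differ by at most 1, and
the parity of their sum, the multiplicity of s² for Γ², decides whether they are equal. -/

lemma matrix_symm_of_const {S : ℕ → Matrix (Fin 2) (Fin 2) ℝ} {C : Matrix (Fin 2) (Fin 2) ℝ}
    (h : ∀ x y : ℕ, x ≠ y →
      ((x : ℝ) - (y : ℝ))⁻¹ • ((S y)ᵀ * matF * S x - matF) = C) : Cᵀ = C := by
  have h1 := h 0 1 (by norm_num)
  have h2 := h 1 0 (by norm_num)
  have hF : matFᵀ = -matF := by
    ext i j; fin_cases i <;> fin_cases j <;> simp [matF]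
  rw [← h1, Matrix.transpose_smul, Matrix.transpose_sub, Matrix.transpose_mul,
    Matrix.transpose_mul, hF, Matrix.transpose_transpose, h1, ← h2]
  simp [Matrix.mul_assoc, ← sub_eq_add_neg]

lemma matrix_eq_rank_one {C : Matrix (Fin 2) (Fin 2) ℝ} {ev α β : ℝ} (hsymm : Cᵀ = C)
    (h_ev : ev ≠ 0) (h_zero : Module.End.HasEigenvalue (Matrix.toLin' C) 0)
    (h_vec : C *ᵥ ![α, β] = ev • ![α, β]) (h_unit : α ^ 2 + β ^ 2 = 1) :
    C = ev • Matrix.vecMulVec ![α, β] ![α, β] := by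
  obtain ⟨v, hv⟩ := h_zero.exists_hasEigenvector
  have hdet : C.det = 0 := by
    rw [← Matrix.exists_mulVec_eq_zero_iff]
    exact ⟨v, hv.2, by simpa using hv.apply_eq_smul⟩
  have h10 : C 1 0 = C 0 1 := congrFun (congrFun hsymm 0) 1
  have e0 := congrFun h_vec 0
  have e1 := congrFun h_vec 1
  simp [Matrix.mulVec, dotProduct, Fin.sum_univ_two] at e0 e1
  rw [Matrix.det_fin_two] at hdet
  rw [h10] at e1 hdet
  -- By symmetry and `det C = 0`, the orthogonal vector (-β, α) lies in the kernel of `C`; `k1` and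
  -- `k2` are its two coordinates.
  have k1 : C 0 1 * β = C 1 1 * α :=
    mul_left_cancel₀ h_ev (by linear_combination C 1 1 * e0 - C 0 1 * e1 - α * hdet)
  have k2 : C 0 1 * α = C 0 0 * β :=
    mul_left_cancel₀ h_ev (by linear_combination C 0 0 * e1 - C 0 1 * e0 - β * hdet)
  ext i j
  fin_cases i <;> fin_cases j <;> simp [h10]
  · linear_combination α * e0 - β * k2 - C 0 0 * h_unit
  · linear_combination β * e0 + α * k2 - C 0 1 * h_unit
  · linear_combination β * e0 + α * k2 - C 0 1 * h_unit
  · linear_combination β * e1 - α * k1 - C 1 1 * h_unit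

lemma vec_form (C : Matrix (Fin 2) (Fin 2) ℝ) (u v : Fin 2 → ℝ) :
    v ⬝ᵥ (C *ᵥ u) = C 0 0 * u 0 * v 0 + C 0 1 * u 1 * v 0 + C 1 0 * u 0 * v 1
      + C 1 1 * u 1 * v 1 := by
  simp [Matrix.mulVec, dotProduct, Fin.sum_univ_two]; ring

lemma tendsto_zero_of_summable_sq {f : ℕ → ℝ} (h : Summable fun n => f n ^ 2) :
    Tendsto f atTop (𝓝 0) := by
  have := (Real.continuous_sqrt.tendsto 0).comp h.tendsto_atTop_zero
  exact (tendsto_zero_iff_abs_tendsto_zero _).2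
    (by simpa [Function.comp_def, Real.sqrt_sq_eq_abs] using this)

section Kernel

variable {A B : ℕ → ℝ} {S : ℕ → Matrix (Fin 2) (Fin 2) ℝ} {C : Matrix (Fin 2) (Fin 2) ℝ}
  {ev α β : ℝ}

lemma twKernel_succ_sub
    (h_rec : ∀ x : ℕ, vecA A B (x + 1) = S x *ᵥ vecA A B x)
    (h_const : ∀ x y : ℕ, x ≠ y →
      ((x : ℝ) - (y : ℝ))⁻¹ • ((S y)ᵀ * matF * S x - matF) = C) {x y : ℕ} (hxy : x ≠ y) :
    twKernel A B (x + 1) (y + 1) - twKernel A B x y = vecA A B y ⬝ᵥ (C *ᵥ vecA A B x) := by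
  rw [← h_const x y hxy]
  unfold twKernel
  rw [h_rec x, h_rec y, Matrix.smul_mulVec, Matrix.sub_mulVec, dotProduct_smul, dotProduct_sub,
    ← Matrix.mulVec_mulVec, ← Matrix.mulVec_mulVec, dotProduct_comm (vecA A B y),
    dotProduct_comm (vecA A B y), Matrix.mulVec_transpose, ← Matrix.dotProduct_mulVec]
  push_cast
  rw [smul_eq_mul, add_sub_add_right_eq_sub]
  ring

/-- The increment of the Tracy–Widom kernel is `ev` times a product of two linear forms. The factor
-sgn(ev) replaces `ev` by its absolute value, which the two square roots in φ absorb. -/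
lemma extendedKernel_sub_succ
    (h_rec : ∀ x : ℕ, vecA A B (x + 1) = S x *ᵥ vecA A B x)
    (h_const : ∀ x y : ℕ, x ≠ y →
      ((x : ℝ) - (y : ℝ))⁻¹ • ((S y)ᵀ * matF * S x - matF) = C)
    (hC : C = ev • Matrix.vecMulVec ![α, β] ![α, β]) {x y : ℕ} (hxy : x ≠ y) :
    extendedKernel A B ev α β x y - extendedKernel A B ev α β (x + 1) (y + 1) =
      hankelSymbol A B ev α β x * hankelSymbol A B ev α β y := by
  have h := twKernel_succ_sub h_rec h_const hxy
  rw [vec_form, hC] at h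
  simp only [extendedKernel, hxy, if_false, add_left_inj]
  have h' : -Real.sign ev * twKernel A B x y - -Real.sign ev * twKernel A B (x + 1) (y + 1) =
      Real.sign ev * (twKernel A B (x + 1) (y + 1) - twKernel A B x y) := by ring
  have hs : Real.sqrt |ev| * Real.sqrt |ev| = Real.sign ev * ev := by
    rw [Real.mul_self_sqrt (abs_nonneg _)]
    rcases lt_trichotomy ev 0 with h | h | h
    · rw [Real.sign_of_neg h, abs_of_neg h]; ring
    · simp [h]
    · rw [Real.sign_of_pos h, abs_of_pos h]; ring
  rw [h', h]
  simp only [hankelSymbol, vecA, Matrix.smul_apply, Matrix.vecMulVec_apply, smul_eq_mul,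
    Matrix.cons_val_zero, Matrix.cons_val_one]
  linear_combination (-(α * A x + β * B x) * (α * A y + β * B y)) * hs

lemma hankelSymbol_sq_summable (h_sq : Summable fun x : ℕ => A x ^ 2 + B x ^ 2) :
    Summable fun n : ℕ => hankelSymbol A B ev α β n ^ 2 := by
  refine Summable.of_nonneg_of_le (fun _ => sq_nonneg _) (fun n => ?_)
    (h_sq.mul_left (|ev| * (α ^ 2 + β ^ 2)))
  rw [hankelSymbol, mul_pow, Real.sq_sqrt (abs_nonneg _), mul_assoc]
  refine mul_le_mul_of_nonneg_left ?_ (abs_nonneg _)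
  nlinarith [sq_nonneg (α * B n - β * A n)]

lemma twKernel_tendsto_zero (h_sq : Summable fun x : ℕ => A x ^ 2 + B x ^ 2) (x y : ℕ) :
    Tendsto (fun N : ℕ => twKernel A B (x + N) (y + N)) atTop (𝓝 0) := by
  have hA : Tendsto A atTop (𝓝 0) := tendsto_zero_of_summable_sq <|
    Summable.of_nonneg_of_le (fun _ => sq_nonneg _) (fun n => by nlinarith [sq_nonneg (B n)]) h_sq
  have hB : Tendsto B atTop (𝓝 0) := tendsto_zero_of_summable_sq <|
    Summable.of_nonneg_of_le (fun _ => sq_nonneg _) (fun n => by nlinarith [sq_nonneg (A n)]) h_sq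
  have hsh : ∀ z : ℕ, Tendsto (fun N : ℕ => z + N) atTop atTop := fun z =>
    tendsto_atTop_mono (fun N => Nat.le_add_left N z) tendsto_id
  have := (((hA.comp (hsh x)).mul (hB.comp (hsh y))).sub
    ((hB.comp (hsh x)).mul (hA.comp (hsh y)))).div_const ((x : ℝ) - y)
  simp only [mul_zero, sub_zero, zero_div] at this
  refine this.congr fun N => ?_
  simp [twKernel, matF, vecA, Matrix.mulVec, dotProduct, Fin.sum_univ_two]
  ring

lemma hasSum_extendedKernel (h_sq : Summable fun x : ℕ => A x ^ 2 + B x ^ 2)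
    (h_rec : ∀ x : ℕ, vecA A B (x + 1) = S x *ᵥ vecA A B x)
    (h_const : ∀ x y : ℕ, x ≠ y →
      ((x : ℝ) - (y : ℝ))⁻¹ • ((S y)ᵀ * matF * S x - matF) = C)
    (hC : C = ev • Matrix.vecMulVec ![α, β] ![α, β]) (x y : ℕ) :
    HasSum (fun k => hankelSymbol A B ev α β (x + k) * hankelSymbol A B ev α β (y + k))
      (extendedKernel A B ev α β x y) := by
  set φ := hankelSymbol A B ev α β with hφ
  have hs : ∀ z, Summable fun k => φ (z + k) ^ 2 := fun z => by
    simpa only [add_comm z] using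
      (summable_nat_add_iff z).2 (hankelSymbol_sq_summable (ev := ev) (α := α) (β := β) h_sq)
  have hsum : Summable fun k => φ (x + k) * φ (y + k) := by
    refine Summable.of_norm_bounded ((hs x).add (hs y)) fun k => ?_
    rw [Real.norm_eq_abs, abs_mul]
    nlinarith [sq_nonneg (|φ (x + k)| - |φ (y + k)|), sq_abs (φ (x + k)), sq_abs (φ (y + k)),
      sq_nonneg (φ (x + k)), sq_nonneg (φ (y + k))]
  by_cases hxy : x = y
  · subst hxy
    simp only [extendedKernel, if_true]
    simpa only [← pow_two] using (hs x).hasSum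
  · rw [hsum.hasSum_iff_tendsto_nat]
    -- Telescoping along the diagonal direction; the remainder is off-diagonal and tends to 0.
    have hpart : ∀ N, ∑ k ∈ Finset.range N, φ (x + k) * φ (y + k) =
        extendedKernel A B ev α β x y - extendedKernel A B ev α β (x + N) (y + N) := by
      intro N
      induction N with
      | zero => simp
      | succ N ih =>
        have := extendedKernel_sub_succ (α := α) (β := β) h_rec h_const hC
          (x := x + N) (y := y + N) (by omega)
        rw [Finset.sum_range_succ, ih, ← this]
        simp only [add_assoc]; ring
    simp only [hpart]
    have ht := ((twKernel_tendsto_zero h_sq x y).const_mul (-Real.sign ev)).const_sub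
      (extendedKernel A B ev α β x y)
    simp only [mul_zero, sub_zero] at ht
    refine ht.congr fun N => ?_
    simp [extendedKernel, hxy]

end Kernel

/-! ### Hilbert–Schmidt operators on `ℓ²` given by their rows -/

lemma memℓp_two_of_summable_sq {f : ℕ → ℂ} (h : Summable fun n => ‖f n‖ ^ 2) :
    Memℓp f 2 := memℓp_gen (by simpa using h)

lemma summable_norm_sq (f : Ell2) : Summable fun n => ‖f n‖ ^ 2 := by
  simpa using (lp.memℓp f).summable (by norm_num)

lemma norm_sq_eq_tsum (f : Ell2) : ‖f‖ ^ 2 = ∑' n, ‖f n‖ ^ 2 := by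
  simpa using lp.norm_rpow_eq_tsum (p := 2) (by norm_num) f

lemma summable_norm_inner_sq {r : ℕ → Ell2} (hr : Summable fun m => ‖r m‖ ^ 2) (f : Ell2) :
    Summable fun m => ‖inner ℂ (r m) f‖ ^ 2 := by
  refine Summable.of_nonneg_of_le (fun _ => sq_nonneg _) (fun m => ?_) (hr.mul_right (‖f‖ ^ 2))
  rw [← mul_pow]
  exact pow_le_pow_left₀ (norm_nonneg _) (norm_inner_le_norm _ _) 2

/-- The operator on `ℓ²` whose `m`-th row is the square-summable family `r m`. -/
noncomputable def opOfRows (r : ℕ → Ell2) (hr : Summable fun m => ‖r m‖ ^ 2) : Ell2 →L[ℂ] Ell2 :=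
  LinearMap.mkContinuous
    { toFun := fun f => ⟨fun m => inner ℂ (r m) f,
        memℓp_two_of_summable_sq (summable_norm_inner_sq hr f)⟩
      map_add' := fun f g => by ext m; exact inner_add_right _ _ _
      map_smul' := fun c f => by ext m; exact inner_smul_right _ _ _ }
    (Real.sqrt (∑' m, ‖r m‖ ^ 2)) (fun f => by
      refine (sq_le_sq₀ (norm_nonneg _) (by positivity)).1 ?_
      rw [mul_pow, Real.sq_sqrt (tsum_nonneg fun _ => sq_nonneg _), norm_sq_eq_tsum,
        ← tsum_mul_right]
      refine (summable_norm_inner_sq hr f).tsum_le_tsum (fun m => ?_) (hr.mul_right _)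
      rw [← mul_pow]
      exact pow_le_pow_left₀ (norm_nonneg _) (norm_inner_le_norm _ _) 2)

@[simp] lemma opOfRows_apply (r : ℕ → Ell2) (hr : Summable fun m => ‖r m‖ ^ 2) (f : Ell2)
    (m : ℕ) : opOfRows r hr f m = inner ℂ (r m) f := rfl

lemma norm_opOfRows_le (r : ℕ → Ell2) (hr : Summable fun m => ‖r m‖ ^ 2) :
    ‖opOfRows r hr‖ ≤ Real.sqrt (∑' m, ‖r m‖ ^ 2) :=
  LinearMap.mkContinuous_norm_le _ (Real.sqrt_nonneg _) _

lemma isCompactOperator_toSpan (r g : Ell2) :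
    IsCompactOperator ((innerSL ℂ r).smulRight g : Ell2 →L[ℂ] Ell2) := by
  have : ((innerSL ℂ r).smulRight g : Ell2 →L[ℂ] Ell2) =
      ((1 : ℂ →L[ℂ] ℂ).smulRight g).comp (innerSL ℂ r) := by ext; simp
  rw [this]
  exact (isCompactOperator_of_locallyCompactSpace_rng ((1 : ℂ →L[ℂ] ℂ).smulRight g)).comp_clm _

/-- Keeping only the first `N` rows gives a finite-rank operator, and the error is bounded in norm
by the Hilbert–Schmidt norm of the remaining rows. -/
lemma isCompactOperator_opOfRows (r : ℕ → Ell2) (hr : Summable fun m => ‖r m‖ ^ 2) :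
    IsCompactOperator (opOfRows r hr) := by
  let T : ℕ → Ell2 →L[ℂ] Ell2 := fun N =>
    ∑ m ∈ Finset.range N, (innerSL ℂ (r m)).smulRight (lp.single 2 m (1 : ℂ))
  have hT : ∀ N, T N ∈ compactOperator (RingHom.id ℂ) Ell2 Ell2 := fun N =>
    Submodule.sum_mem _ fun m _ => isCompactOperator_toSpan _ _
  have hTa : ∀ N f m, T N f m = if m < N then inner ℂ (r m) f else 0 := by
    intro N f m
    have h : T N f m = ∑ i ∈ Finset.range N,
        inner ℂ (r i) f * (lp.single 2 i (1 : ℂ) : Ell2) m := by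
      simp only [T, _root_.sum_apply, lp.coeFn_sum, Finset.sum_apply]
      rfl
    simp [h, lp.single_apply, Pi.single_apply]
  refine isCompactOperator_of_tendsto (l := atTop) (F := T) ?_ (Eventually.of_forall hT)
  rw [tendsto_iff_norm_sub_tendsto_zero]
  have hs : ∀ N, Summable fun m => ‖if m < N then (0 : Ell2) else r m‖ ^ 2 := fun N =>
    Summable.of_nonneg_of_le (fun _ => sq_nonneg _) (fun m => by split_ifs <;> simp) hr
  have hd : ∀ N, T N - opOfRows r hr = -opOfRows _ (hs N) := by
    intro N
    ext f m
    have : (T N - opOfRows r hr) f m = T N f m - opOfRows r hr f m := rfl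
    rw [this, hTa]
    have : (-opOfRows _ (hs N)) f m = - (opOfRows _ (hs N) f m) := rfl
    rw [this]
    simp only [opOfRows_apply]
    split_ifs <;> simp
  have htail : Tendsto (fun N => Real.sqrt (∑' m, ‖r (m + N)‖ ^ 2)) atTop (𝓝 0) := by
    simpa [Function.comp_def] using (Real.continuous_sqrt.tendsto 0).comp
      (tendsto_sum_nat_add fun m => ‖r m‖ ^ 2)
  refine squeeze_zero (fun _ => norm_nonneg _) (fun N => ?_) htail
  rw [hd, norm_neg]
  refine (norm_opOfRows_le _ _).trans (Real.sqrt_le_sqrt (le_of_eq ?_))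
  rw [← (hs N).sum_add_tsum_nat_add N, Finset.sum_eq_zero, zero_add]
  · simp
  · intro m hm; simp [Finset.mem_range.1 hm]

/-! ### Shifts -/

/-- The forward shift on `ℓ²`. -/
noncomputable def shiftR : Ell2 →ₗ[ℂ] Ell2 where
  toFun f := ⟨fun n => Nat.casesOn n 0 fun k => f k, memℓp_two_of_summable_sq <| by
    rw [← summable_nat_add_iff 1]; exact summable_norm_sq f⟩
  map_add' f g := by
    ext n; cases n
    · exact (add_zero (0 : ℂ)).symm
    · rfl
  map_smul' c f := by
    ext n; cases n
    · exact (mul_zero c).symm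
    · rfl

/-- The backward shift on `ℓ²`. -/
noncomputable def shiftL : Ell2 →ₗ[ℂ] Ell2 where
  toFun f := ⟨fun n => f (n + 1), memℓp_two_of_summable_sq <|
    (summable_nat_add_iff 1).2 (summable_norm_sq f)⟩
  map_add' _ _ := rfl
  map_smul' _ _ := rfl

@[simp] lemma shiftR_zero (f : Ell2) : shiftR f 0 = 0 := rfl
@[simp] lemma shiftR_succ (f : Ell2) (n : ℕ) : shiftR f (n + 1) = f n := rfl
@[simp] lemma shiftL_apply (f : Ell2) (n : ℕ) : shiftL f n = f (n + 1) := rfl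

lemma tendsto_coord_zero (f : Ell2) : Tendsto (fun n => f n) atTop (𝓝 0) := by
  rw [tendsto_zero_iff_norm_tendsto_zero]
  exact tendsto_zero_of_summable_sq (summable_norm_sq f)

/-- A sequence in the kernel has period 2, and its coordinates tend to 0. -/
lemma shiftR_sub_shiftL_injective : Function.Injective (shiftR - shiftL) := by
  rw [injective_iff_map_eq_zero]
  intro f hf
  have h : ∀ n, shiftR f n = f (n + 1) := fun n =>
    sub_eq_zero.1 (congrArg (fun g : Ell2 => g n) hf)
  have h2 : ∀ n, f (n + 2) = f n := fun n => (h (n + 1)).symm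
  have h3 : ∀ n k, f (n + 2 * k) = f n := by
    intro n k
    induction k with
    | zero => rfl
    | succ k ih => rw [← ih, ← h2 (n + 2 * k)]; rfl
  ext n
  have ht : Tendsto (fun k => f (n + 2 * k)) atTop (𝓝 0) :=
    (tendsto_coord_zero f).comp (tendsto_atTop_mono (fun k => show k ≤ n + 2 * k by omega) tendsto_id)
  simp only [h3] at ht
  exact tendsto_nhds_unique tendsto_const_nhds ht

lemma shiftR_eq_smul {f : Ell2} {z : ℂ} (h : shiftR f = z • f) : f = 0 := by
  have h' : ∀ n, shiftR f n = z * f n := fun n => congrArg (fun g : Ell2 => g n) h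
  ext n
  by_cases hz : z = 0
  · have := h' (n + 1); simpa [hz] using this
  · induction n with
    | zero => simpa [hz] using (h' 0).symm
    | succ n ih =>
      have := h' (n + 1)
      rw [shiftR_succ, ih] at this
      simpa [hz] using this.symm

/-- Over ℂ, a nonzero finite-dimensional invariant subspace would contain an eigenvector of the
forward shift. -/
lemma shiftR_invariant_eq_bot {V : Submodule ℂ Ell2} [FiniteDimensional ℂ V]
    (hV : ∀ f ∈ V, shiftR f ∈ V) : V = ⊥ := by
  by_contra hne
  have : Nontrivial V := Submodule.nontrivial_iff_ne_bot.2 hne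
  obtain ⟨z, hz⟩ := Module.End.exists_eigenvalue (shiftR.restrict hV)
  obtain ⟨v, hv⟩ := hz.exists_hasEigenvector
  refine hv.2 (Subtype.ext (shiftR_eq_smul (z := z) ?_))
  simpa using congrArg Subtype.val hv.apply_eq_smul

/-! ### Hankel operators -/

section Hankel

variable {φ : ℕ → ℝ} {Γ : Ell2 →L[ℂ] Ell2}

lemma hankel_shiftR (hΓ : IsRepresentedBy Γ (hankelMatrix φ)) (f : Ell2) :
    Γ (shiftR f) = shiftL (Γ f) := by
  ext m
  have h := hΓ (shiftR f) m
  rw [← hasSum_nat_add_iff' 1] at h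
  simp only [Finset.range_one, Finset.sum_singleton, shiftR_zero, mul_zero, sub_zero,
    shiftR_succ] at h
  refine h.unique ((hΓ f (m + 1)).congr_fun fun n => ?_)
  simp only [hankelMatrix]
  rw [show m + (n + 1) = m + 1 + n by ring]

lemma hankel_shiftL_succ (hΓ : IsRepresentedBy Γ (hankelMatrix φ)) (f : Ell2) (m : ℕ) :
    Γ (shiftL f) (m + 1) = Γ f m - φ m * f 0 := by
  have h := hΓ f m
  rw [← hasSum_nat_add_iff' 1] at h
  simp only [Finset.range_one, Finset.sum_singleton] at h
  refine ((hΓ (shiftL f) (m + 1)).congr_fun fun n => ?_).unique h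
  simp only [hankelMatrix, shiftL_apply]
  rw [show m + (n + 1) = m + 1 + n by ring]

/-- ΓL agrees with RΓ on such `f` except in coordinate 0, which R leaves empty; hence the defect
along the first basis vector. -/
lemma hankel_shiftL (hΓ : IsRepresentedBy Γ (hankelMatrix φ)) {f : Ell2} {z : ℂ}
    (hf : Γ f = z • f) (h0 : f 0 = 0) :
    Γ (shiftL f) = z • shiftR f + lp.single 2 0 (Γ (shiftL f) 0) := by
  ext m
  have : (z • shiftR f + lp.single 2 0 (Γ (shiftL f) 0) : Ell2) m =
    z * shiftR f m + (lp.single 2 0 (Γ (shiftL f) 0) : Ell2) m := rfl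
  rw [this]
  cases m with
  | zero => simp
  | succ m =>
    rw [hankel_shiftL_succ hΓ, hf, h0]
    simp

lemma hankel_shift_sub_mem (hΓ : IsRepresentedBy Γ (hankelMatrix φ)) {f : Ell2} {z : ℂ}
    (hf : Γ f = z • f) (h0 : f 0 = 0) (hc : Γ (shiftL f) 0 = 0) :
    (shiftR - shiftL) f ∈ Module.End.eigenspace (Γ : Ell2 →ₗ[ℂ] Ell2) (-z) := by
  have h1 := hankel_shiftL hΓ hf h0
  rw [hc, lp.single_zero, add_zero] at h1
  rw [Module.End.mem_eigenspace_iff]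
  simp only [ContinuousLinearMap.coe_coe, LinearMap.sub_apply, map_sub]
  rw [h1, hankel_shiftR hΓ, hf, map_smul]
  module

lemma finrank_le_finrank_add_one {E : Type*} [AddCommGroup E] [Module ℂ E]
    {V W : Submodule ℂ E} [FiniteDimensional ℂ V] [FiniteDimensional ℂ W]
    (l : E →ₗ[ℂ] ℂ) {D : E →ₗ[ℂ] E} (hD : Function.Injective D)
    (h : ∀ f ∈ V, l f = 0 → D f ∈ W) :
    Module.finrank ℂ V ≤ Module.finrank ℂ W + 1 := by
  let l' : V →ₗ[ℂ] ℂ := l.comp V.subtype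
  have h1 := l'.finrank_range_add_finrank_ker
  have h2 : Module.finrank ℂ (LinearMap.range l') ≤ 1 := by
    simpa using Submodule.finrank_le (LinearMap.range l')
  let D' : LinearMap.ker l' →ₗ[ℂ] W :=
    LinearMap.codRestrict W (D.comp (V.subtype.comp (LinearMap.ker l').subtype))
      fun f => h _ f.1.2 f.2
  have h3 : Function.Injective D' := fun f g hfg =>
    Subtype.ext (Subtype.ext (hD (congrArg Subtype.val hfg)))
  have h4 := LinearMap.finrank_le_finrank_of_injective h3
  omega

/-- R - L sends an s-eigenvector `f` to the (-s)-eigenspace once both `f 0` and `Γ (shiftL f) 0`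
vanish. The case split shows that one of these two linear conditions always suffices. -/
lemma finrank_eigenspace_le (hΓ : IsRepresentedBy Γ (hankelMatrix φ)) (hsa : IsSelfAdjoint Γ)
    (hcpt : IsCompactOperator Γ) {s : ℝ} (hs : s ≠ 0) :
    Module.finrank ℂ (Module.End.eigenspace (Γ : Ell2 →ₗ[ℂ] Ell2) (s : ℂ)) ≤
      Module.finrank ℂ (Module.End.eigenspace (Γ : Ell2 →ₗ[ℂ] Ell2) (-(s : ℂ))) + 1 := by
  have hs' : (s : ℂ) ≠ 0 := by exact_mod_cast hs
  have := ContinuousLinearMap.finite_dimensional_eigenspace hcpt (s : ℂ) hs'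
  have := ContinuousLinearMap.finite_dimensional_eigenspace hcpt (-(s : ℂ)) (neg_ne_zero.2 hs')
  have hsym := ContinuousLinearMap.isSelfAdjoint_iff_isSymmetric.1 hsa
  let ev : Ell2 →ₗ[ℂ] ℂ :=
    { toFun := fun f => f 0, map_add' := fun _ _ => rfl, map_smul' := fun _ _ => rfl }
  by_cases hE : ∃ g : Ell2, Γ (Γ g) = ((s : ℂ) * s) • g ∧ g 0 ≠ 0
  · obtain ⟨g, hg, hg0⟩ := hE
    refine finrank_le_finrank_add_one ev shiftR_sub_shiftL_injective fun f hf h0 => ?_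
    have hf : Γ f = (s : ℂ) • f := Module.End.mem_eigenspace_iff.1 hf
    refine hankel_shift_sub_mem hΓ hf h0 ?_
    have h1 := hankel_shiftL hΓ hf h0
    set c := Γ (shiftL f) 0
    -- Applying Γ² to R f gives s² R f plus the defect s c e₀. Pairing with `g`, an s²-eigenvector
    -- of the symmetric Γ², cancels the main terms and leaves `c = 0` since `g 0 ≠ 0`.
    have h2 : Γ (Γ (shiftR f)) = ((s : ℂ) * s) • shiftR f + (s : ℂ) • lp.single 2 0 c := by
      rw [hankel_shiftR hΓ, hf, map_smul, map_smul, h1, smul_add, smul_smul]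
    have h3 : inner ℂ g (Γ (Γ (shiftR f))) = inner ℂ (Γ (Γ g)) (shiftR f) := by
      have a1 := hsym g (Γ (shiftR f))
      have a2 := hsym (Γ g) (shiftR f)
      simp only [ContinuousLinearMap.coe_coe] at a1 a2
      rw [← a1, ← a2]
    rw [h2, hg, inner_add_right, inner_smul_right, inner_smul_left, inner_smul_right,
      lp.inner_single_right] at h3
    simpa [hs, hg0] using h3
  -- Here every s²-eigenvector of Γ² vanishes at 0, so `f 0 = 0` is automatic and the functional can
  -- be spent on the other condition.
  · push Not at hE
    refine finrank_le_finrank_add_one (ev ∘ₗ (Γ : Ell2 →ₗ[ℂ] Ell2) ∘ₗ shiftL)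
      shiftR_sub_shiftL_injective fun f hf h0 => ?_
    have hf : Γ f = (s : ℂ) • f := Module.End.mem_eigenspace_iff.1 hf
    refine hankel_shift_sub_mem hΓ hf (hE f ?_) h0
    rw [hf, map_smul, hf, smul_smul]

lemma specMult_zero_hankel_sq (hΓ : IsRepresentedBy Γ (hankelMatrix φ)) (hsa : IsSelfAdjoint Γ) :
    specMult (Γ ∘L Γ) 0 = 0 ∨ specMult (Γ ∘L Γ) 0 = ⊤ := by
  have hsym := ContinuousLinearMap.isSelfAdjoint_iff_isSymmetric.1 hsa
  set V := Module.End.eigenspace ((Γ ∘L Γ : Ell2 →L[ℂ] Ell2) : Ell2 →ₗ[ℂ] Ell2) ((0 : ℝ) : ℂ)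
    with hV
  have hmem : ∀ f, f ∈ V ↔ Γ f = 0 := by
    intro f
    rw [hV, Module.End.mem_eigenspace_iff]
    simp only [ContinuousLinearMap.coe_coe, ContinuousLinearMap.comp_apply, Complex.ofReal_zero,
      zero_smul]
    refine ⟨fun h => ?_, fun h => by rw [h, map_zero]⟩
    have := hsym f (Γ f)
    simp only [ContinuousLinearMap.coe_coe] at this
    rw [h, inner_zero_right] at this
    exact inner_self_eq_zero.1 this
  by_cases hfd : FiniteDimensional ℂ V
  · left
    have : V = ⊥ := shiftR_invariant_eq_bot fun f hf => by
      rw [hmem] at hf ⊢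
      rw [hankel_shiftR hΓ, hf, map_zero]
    rw [specMult, ← hV, this]
    simp
  · right
    rw [specMult, ← hV, Cardinal.toENat_eq_top]
    exact not_lt.1 fun h => hfd (Module.rank_lt_aleph0_iff.1 h)

end Hankel

/-! ### Hilbert–Schmidt Hankel operators and their squares -/

section HankelConstruction

variable {φ : ℕ → ℝ}

/-- The rows of the Hankel matrix of a square-summable symbol. -/
noncomputable def hankelRow (hφ : Summable fun n => φ n ^ 2) (m : ℕ) : Ell2 :=
  ⟨fun n => (φ (m + n) : ℂ), memℓp_two_of_summable_sq <| by
    simpa [add_comm m] using (summable_nat_add_iff m).2 hφ⟩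

@[simp] lemma hankelRow_apply (hφ : Summable fun n => φ n ^ 2) (m n : ℕ) :
    hankelRow hφ m n = (φ (m + n) : ℂ) := rfl

/-- The antidiagonal of sum `n` has `n + 1` points, so the double sum is ∑ (n+1) φ(n)². -/
lemma summable_hankel_prod (hφ : Summable fun n => φ n ^ 2)
    (hw : Summable fun n : ℕ => (n : ℝ) * φ n ^ 2) :
    Summable fun p : ℕ × ℕ => φ (p.1 + p.2) ^ 2 := by
  have key : Summable fun x : Σ n : ℕ, Finset.HasAntidiagonal.antidiagonal n =>
      φ ((x.2 : ℕ × ℕ).1 + (x.2 : ℕ × ℕ).2) ^ 2 := by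
    rw [summable_sigma_of_nonneg (fun x => by positivity)]
    refine ⟨fun n => (hasSum_fintype _).summable, (hw.add hφ).congr fun n => ?_⟩
    have h : ∀ p : Finset.HasAntidiagonal.antidiagonal n,
        φ ((p : ℕ × ℕ).1 + (p : ℕ × ℕ).2) ^ 2 = φ n ^ 2 := fun p => by
      rw [Finset.HasAntidiagonal.mem_antidiagonal.1 p.2]
    simp only [h, tsum_fintype, Finset.sum_const, Finset.card_univ, Fintype.card_coe,
      Finset.Nat.card_antidiagonal, nsmul_eq_mul]
    push_cast
    ring
  exact Finset.HasAntidiagonal.sigmaAntidiagonalEquivProd.summable_iff.1 key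

lemma summable_norm_hankelRow (hφ : Summable fun n => φ n ^ 2)
    (hw : Summable fun n : ℕ => (n : ℝ) * φ n ^ 2) :
    Summable fun m => ‖hankelRow hφ m‖ ^ 2 := by
  simpa [norm_sq_eq_tsum] using
    ((summable_prod_of_nonneg fun _ => sq_nonneg _).1 (summable_hankel_prod hφ hw)).2

lemma isRepresentedBy_opOfRows (hφ : Summable fun n => φ n ^ 2)
    (hr : Summable fun m => ‖hankelRow hφ m‖ ^ 2) :
    IsRepresentedBy (opOfRows (hankelRow hφ) hr) (hankelMatrix φ) := fun f m => by
  simpa [hankelMatrix, mul_comm] using lp.hasSum_inner (𝕜 := ℂ) (hankelRow hφ m) f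

lemma hankel_single (hφ : Summable fun n => φ n ^ 2) {Γ : Ell2 →L[ℂ] Ell2}
    (hΓ : IsRepresentedBy Γ (hankelMatrix φ)) (m : ℕ) :
    Γ (lp.single 2 m 1) = hankelRow hφ m := by
  ext n
  refine (hΓ _ n).unique ?_
  have := hasSum_ite_eq m (φ (m + n) : ℂ)
  refine this.congr_fun fun k => ?_
  by_cases h : k = m
  · subst h; simp [hankelMatrix, add_comm]
  · simp [hankelMatrix, h, lp.single_apply]

lemma hankel_apply (hφ : Summable fun n => φ n ^ 2) {Γ : Ell2 →L[ℂ] Ell2}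
    (hΓ : IsRepresentedBy Γ (hankelMatrix φ)) (f : Ell2) (m : ℕ) :
    Γ f m = inner ℂ (hankelRow hφ m) f := by
  refine (hΓ f m).unique ?_
  simpa [hankelMatrix, mul_comm] using lp.hasSum_inner (𝕜 := ℂ) (hankelRow hφ m) f

lemma isSelfAdjoint_hankel (hφ : Summable fun n => φ n ^ 2) {Γ : Ell2 →L[ℂ] Ell2}
    (hΓ : IsRepresentedBy Γ (hankelMatrix φ)) : IsSelfAdjoint Γ := by
  rw [ContinuousLinearMap.isSelfAdjoint_iff']
  ext f m
  rw [hankel_apply hφ hΓ, ← hankel_single hφ hΓ, ← ContinuousLinearMap.adjoint_inner_right,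
    lp.inner_single_left]
  simp

lemma hankel_sq_isRepresentedBy (hφ : Summable fun n => φ n ^ 2) {Γ : Ell2 →L[ℂ] Ell2}
    (hΓ : IsRepresentedBy Γ (hankelMatrix φ)) {M : ℕ → ℕ → ℝ}
    (hM : ∀ x y, HasSum (fun k => φ (x + k) * φ (y + k)) (M x y)) :
    IsRepresentedBy (Γ ∘L Γ) M := fun f m => by
  have hsym := ContinuousLinearMap.isSelfAdjoint_iff_isSymmetric.1 (isSelfAdjoint_hankel hφ hΓ)
  -- By self-adjointness, row `m` of Γ² is Γ applied to row `m` of Γ.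
  have h1 : (Γ ∘L Γ) f m = inner ℂ (Γ (hankelRow hφ m)) f := by
    rw [ContinuousLinearMap.comp_apply, hankel_apply hφ hΓ]
    exact (hsym _ _).symm
  have h2 : ∀ n, Γ (hankelRow hφ m) n = (M m n : ℂ) := fun n => by
    refine (hΓ _ n).unique ?_
    have := Complex.hasSum_ofReal.2 (hM m n)
    refine this.congr_fun fun k => ?_
    simp [hankelMatrix, mul_comm]
  rw [h1]
  simpa [h2, mul_comm] using lp.hasSum_inner (𝕜 := ℂ) (Γ (hankelRow hφ m)) f

end HankelConstruction

/-! ### Spectral multiplicities -/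

lemma specMult_eq_finrank {H : Type*} [NormedAddCommGroup H] [InnerProductSpace ℂ H]
    (W : H →L[ℂ] H) (t : ℝ)
    [FiniteDimensional ℂ (Module.End.eigenspace (W : H →ₗ[ℂ] H) (t : ℂ))] :
    specMult W t = (Module.finrank ℂ (Module.End.eigenspace (W : H →ₗ[ℂ] H) (t : ℂ)) : ℕ) := by
  rw [specMult, ← Module.finrank_eq_rank, Cardinal.toENat_nat]

lemma finrank_eigenspace_sq {E : Type*} [AddCommGroup E] [Module ℂ E] (T : Module.End ℂ E)
    {z : ℂ} (hz : z ≠ 0) [FiniteDimensional ℂ (T.eigenspace z)]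
    [FiniteDimensional ℂ (T.eigenspace (-z))] :
    Module.finrank ℂ ((T * T).eigenspace (z * z)) =
      Module.finrank ℂ (T.eigenspace z) + Module.finrank ℂ (T.eigenspace (-z)) := by
  have hinf : T.eigenspace z ⊓ T.eigenspace (-z) = ⊥ := by
    rw [eq_bot_iff]
    rintro f ⟨h1, h2⟩
    have h1 : T f = z • f := Module.End.mem_eigenspace_iff.1 h1
    have h2 : T f = -z • f := Module.End.mem_eigenspace_iff.1 h2
    have h3 : (2 * z) • f = 0 := by
      rw [two_mul, add_smul]; nth_rw 1 [← h1]; rw [h2]; module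
    exact (smul_eq_zero.1 h3).resolve_left (mul_ne_zero two_ne_zero hz)
  have hsup : T.eigenspace z ⊔ T.eigenspace (-z) = (T * T).eigenspace (z * z) := by
    apply le_antisymm
    · refine sup_le ?_ ?_ <;> intro f hf <;> rw [Module.End.mem_eigenspace_iff] at hf ⊢ <;>
        rw [Module.End.mul_apply, hf, map_smul, hf, smul_smul]
      rw [neg_mul_neg]
    · intro f hf
      rw [Module.End.mem_eigenspace_iff, Module.End.mul_apply] at hf
      have hdec : f = (2 * z)⁻¹ • (z • f + T f) + (2 * z)⁻¹ • (z • f - T f) := by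
        rw [← smul_add, add_add_sub_cancel, ← add_smul, ← two_mul, smul_smul,
          inv_mul_cancel₀ (mul_ne_zero two_ne_zero hz), one_smul]
      rw [hdec]
      refine Submodule.add_mem_sup (Submodule.smul_mem _ _ ?_) (Submodule.smul_mem _ _ ?_) <;>
        rw [Module.End.mem_eigenspace_iff]
      · rw [map_add, map_smul, hf]; module
      · rw [map_sub, map_smul, hf]; module
  have := Submodule.finrank_sup_add_finrank_inf_eq (T.eigenspace z) (T.eigenspace (-z))
  rwa [hinf, hsup, finrank_bot, add_zero] at this

lemma eq_of_even_of_le {p q : ℕ} (h1 : p ≤ q + 1) (h2 : q ≤ p + 1)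
    (h : Even ((p : ℕ∞) + q)) : p = q := by
  obtain ⟨r, hr⟩ := h
  -- Parity is taken in `ℕ∞`, where the witness could be `⊤`; finiteness of `p + q` excludes this.
  have hne : r ≠ ⊤ := by rintro rfl; exact ENat.natCast_ne_top (p + q) (by push_cast; rw [hr]; rfl)
  lift r to ℕ using hne
  have : p + q = r + r := by exact_mod_cast hr
  omega

lemma abs_sub_eq_one_of_odd_of_le {p q : ℕ} (h1 : p ≤ q + 1) (h2 : q ≤ p + 1)
    (h : Odd ((p : ℕ∞) + q)) : |(p : ℤ) - q| = 1 := by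
  obtain ⟨r, hr⟩ := h
  have hne : r ≠ ⊤ := by rintro rfl; exact ENat.natCast_ne_top (p + q) (by push_cast; rw [hr]; rfl)
  lift r to ℕ using hne
  have : p + q = 2 * r + 1 := by exact_mod_cast hr
  rw [abs_eq one_pos.le]
  omega

lemma hankel_specMult {φ : ℕ → ℝ} {Γ : Ell2 →L[ℂ] Ell2}
    (hΓ : IsRepresentedBy Γ (hankelMatrix φ)) (hsa : IsSelfAdjoint Γ)
    (hcpt : IsCompactOperator Γ) {t : ℝ} (ht : 0 < t) :
    specMult (Γ ∘L Γ) t < ⊤ ∧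
    specMult (Γ ∘L Γ) t = specMult Γ (Real.sqrt t) + specMult Γ (-Real.sqrt t) ∧
    (Even (specMult (Γ ∘L Γ) t) → specMult Γ (Real.sqrt t) = specMult Γ (-Real.sqrt t)) ∧
    (Odd (specMult (Γ ∘L Γ) t) →
      |((specMult Γ (Real.sqrt t)).toNat : ℤ) - ((specMult Γ (-Real.sqrt t)).toNat : ℤ)| = 1) := by
  have hs : Real.sqrt t ≠ 0 := (Real.sqrt_pos.2 ht).ne'
  have hst : (t : ℂ) = (Real.sqrt t : ℂ) * Real.sqrt t := by
    rw [← Complex.ofReal_mul, Real.mul_self_sqrt ht.le]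
  have hneg : ((-Real.sqrt t : ℝ) : ℂ) = -(Real.sqrt t : ℂ) := Complex.ofReal_neg _
  have hsc : (Real.sqrt t : ℂ) ≠ 0 := by exact_mod_cast hs
  have h1 := finrank_eigenspace_le hΓ hsa hcpt hs
  have h2 := finrank_eigenspace_le hΓ hsa hcpt (neg_ne_zero.2 hs)
  have i1 := ContinuousLinearMap.finite_dimensional_eigenspace hcpt (Real.sqrt t : ℂ) hsc
  have i2 := ContinuousLinearMap.finite_dimensional_eigenspace hcpt ((-Real.sqrt t : ℝ) : ℂ)
    (by rw [hneg]; exact neg_ne_zero.2 hsc)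
  have i3 := ContinuousLinearMap.finite_dimensional_eigenspace
    (T := Γ ∘L Γ) (hcpt.comp_clm Γ) (t : ℂ) (by exact_mod_cast ht.ne')
  have e1 := specMult_eq_finrank Γ (Real.sqrt t)
  have e2 := specMult_eq_finrank Γ (-Real.sqrt t)
  have e3 := specMult_eq_finrank (Γ ∘L Γ) t
  rw [hneg] at h2 e2 i2
  rw [neg_neg] at h2
  have e4 : Module.finrank ℂ (Module.End.eigenspace
      ((Γ ∘L Γ : Ell2 →L[ℂ] Ell2) : Ell2 →ₗ[ℂ] Ell2) (t : ℂ)) =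
      Module.finrank ℂ (Module.End.eigenspace (Γ : Ell2 →ₗ[ℂ] Ell2) (Real.sqrt t : ℂ)) +
      Module.finrank ℂ (Module.End.eigenspace (Γ : Ell2 →ₗ[ℂ] Ell2) (-(Real.sqrt t : ℂ))) := by
    rw [hst]
    exact finrank_eigenspace_sq (Γ : Ell2 →ₗ[ℂ] Ell2) hsc
  rw [e4] at e3
  rw [e1, e2, e3]
  refine ⟨ENat.natCast_lt_top _, Nat.cast_add _ _, fun h => ?_, fun h => ?_⟩
  · rw [Nat.cast_add] at h
    exact congrArg _ (eq_of_even_of_le h1 h2 h)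
  · rw [Nat.cast_add] at h
    exact abs_sub_eq_one_of_odd_of_le h1 h2 h

end DiscreteIntegrable

theorem mainTheorem5
    (A B : ℕ → ℝ) (S : ℕ → Matrix (Fin 2) (Fin 2) ℝ) (C : Matrix (Fin 2) (Fin 2) ℝ)
    (ev α β : ℝ)
    (h_sq : Summable fun x : ℕ => A x ^ 2 + B x ^ 2)
    (h_rec : ∀ x : ℕ,
      DiscreteIntegrable.vecA A B (x + 1) = S x *ᵥ DiscreteIntegrable.vecA A B x)
    (h_const : ∀ x y : ℕ, x ≠ y →
      ((x : ℝ) - (y : ℝ))⁻¹ •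
        ((S y)ᵀ * DiscreteIntegrable.matF * S x - DiscreteIntegrable.matF) = C)
    (h_ev : ev ≠ 0)
    (h_zero : Module.End.HasEigenvalue (Matrix.toLin' C) 0)
    (h_vec : C *ᵥ ![α, β] = ev • ![α, β])
    (h_unit : α ^ 2 + β ^ 2 = 1)
    (h_trace : Summable fun n : ℕ =>
      (n : ℝ) * DiscreteIntegrable.hankelSymbol A B ev α β n ^ 2) :
    ∃ Γ K : DiscreteIntegrable.Ell2 →L[ℂ] DiscreteIntegrable.Ell2,
      DiscreteIntegrable.IsRepresentedBy Γ
        (DiscreteIntegrable.hankelMatrix (DiscreteIntegrable.hankelSymbol A B ev α β)) ∧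
      DiscreteIntegrable.IsRepresentedBy K
        (DiscreteIntegrable.extendedKernel A B ev α β) ∧
      K = Γ ∘L Γ ∧
      IsCompactOperator Γ ∧ IsSelfAdjoint Γ ∧
      IsCompactOperator K ∧ IsSelfAdjoint K ∧
      (DiscreteIntegrable.specMult K 0 = 0 ∨ DiscreteIntegrable.specMult K 0 = ⊤) ∧
      ∀ t : ℝ, 0 < t →
        DiscreteIntegrable.specMult K t < ⊤ ∧
        DiscreteIntegrable.specMult K t =
          DiscreteIntegrable.specMult Γ (Real.sqrt t) +
            DiscreteIntegrable.specMult Γ (-Real.sqrt t) ∧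
        (Even (DiscreteIntegrable.specMult K t) →
          DiscreteIntegrable.specMult Γ (Real.sqrt t) =
            DiscreteIntegrable.specMult Γ (-Real.sqrt t)) ∧
        (Odd (DiscreteIntegrable.specMult K t) →
          |((DiscreteIntegrable.specMult Γ (Real.sqrt t)).toNat : ℤ) -
            ((DiscreteIntegrable.specMult Γ (-Real.sqrt t)).toNat : ℤ)| = 1) := by
  have hC := DiscreteIntegrable.matrix_eq_rank_one
    (DiscreteIntegrable.matrix_symm_of_const h_const) h_ev h_zero h_vec h_unit
  have hφ := DiscreteIntegrable.hankelSymbol_sq_summable (ev := ev) (α := α) (β := β) h_sq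
  have hr := DiscreteIntegrable.summable_norm_hankelRow hφ h_trace
  have hΓ := DiscreteIntegrable.isRepresentedBy_opOfRows hφ hr
  have hcpt := DiscreteIntegrable.isCompactOperator_opOfRows _ hr
  have hsa := DiscreteIntegrable.isSelfAdjoint_hankel hφ hΓ
  have hK := DiscreteIntegrable.hankel_sq_isRepresentedBy hφ hΓ
    (DiscreteIntegrable.hasSum_extendedKernel h_sq h_rec h_const hC)
  refine ⟨_, _, hΓ, hK, rfl, hcpt, hsa, hcpt.comp_clm _,
    ?_,
    DiscreteIntegrable.specMult_zero_hankel_sq hΓ hsa,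
    fun t ht => DiscreteIntegrable.hankel_specMult hΓ hsa hcpt ht⟩
  have h := hsa.pow 2
  rw [pow_two] at h
  exact h
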